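/- Let $K,T\ge 1$ be integers, let $G$ be an undirected graph on the arms $[K]=\{1,\dots,K\}$ with all self-loops included, let $\mathcal I(G)$ be the family of its independent sets (two distinct arms of $I\in\mathcal I(G)$ are never adjacent) and let $\alpha=\max_{I\in\mathcal I(G)}|I|$ be its independence number. Let $P$ be a probability distribution on $[0,1]^K$ with means $\mu_1,\dots,\mu_K$, and put $\Delta_a=\max_b\mu_b-\mu_a$. In each round $t=1,\dots,T$ a reward vector $X_t=(X_{t,a})_{a\in[K]}$ is drawn from $P$, independently of the past; the learner pulls an arm $a_t$, chosen on the basis of the past and possibly of private randomness, collects $X_{t,a_t}$ and observes $X_{t,a}$ for $a=a_t$ and for all neighbours $a$ of $a_t$. The pseudo-regret is $$\bar R_T=\max_{a\in[K]}\mathbb E\Big[\sum_{t=1}^T X_{t,a}-\sum_{t=1}^T X_{t,a_t}\Big].$$ Let $n_a^{t-1}$ be the number of rounds before round $t$ in which the reward of arm $a$ was observed, and let $\hat\mu_a^{t-1}$ be the average of these observed rewards. The algorithm UCB-N with confidence parameter $\delta$ pulls in every round $t\le T$ an arm that maximizes $$\hat\mu_a^{t-1}+\sqrt{\frac{c\,\log(2TK/\delta)}{n_a^{t-1}}}\qquad(\text{read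 as }+\infty\text{ if }n_a^{t-1}=0),$$ where ties are broken arbitrarily on the basis of the past and of private randomness, and where the constant $c$ is any fixed number in $[\tfrac12,2]$. **Theorem.** With $\delta=1/T$, the pseudo-regret of UCB-N satisfies, for every such $c$, $$\bar R_T\le 8\log(2KT^2)\,\big(\log_2\alpha+3\big)\max_{I\in\mathcal I(G)}\ \sum_{a\in I,\ \Delta_a>0}\frac1{\Delta_a}+2 .$$ -/

import Mathlib

open MeasureTheory ProbabilityTheory

noncomputable section

namespace FeedbackBandit

variable {K : ℕ} {Ω : Type*}

/-- Pulling the arm `a` reveals the reward of the arm `b`. The graph is undirected and every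
self-loop is included, so `b` is revealed when `b = a` or `b` is a neighbour of `a`. -/
def Observes (G : SimpleGraph (Fin K)) (a b : Fin K) : Prop :=
  b = a ∨ G.Adj a b

/-- The mean reward `μ_a` of the arm `a` under the joint reward law `P`. -/
def armMean (P : Measure (Fin K → ℝ)) (a : Fin K) : ℝ :=
  ∫ x, x a ∂P

/-- The gap `Δ_a = max_b μ_b - μ_a`. -/
def gap (P : Measure (Fin K → ℝ)) (a : Fin K) : ℝ :=
  (⨆ b, armMean P b) - armMean P a

open Classical in
/-- The rounds among the first `t` (the rounds are `0, 1, 2, …`) in which the reward of `a` was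
observed along the sample point `ω`, when `A s` is the arm pulled in round `s`. -/
def obsRounds (G : SimpleGraph (Fin K)) (A : ℕ → Ω → Fin K) (t : ℕ) (ω : Ω) (a : Fin K) :
    Finset ℕ :=
  (Finset.range t).filter fun s => Observes G (A s ω) a

/-- The number of observations of the arm `a` in the first `t` rounds. -/
def obsCount (G : SimpleGraph (Fin K)) (A : ℕ → Ω → Fin K) (t : ℕ) (ω : Ω) (a : Fin K) : ℕ :=
  (obsRounds G A t ω a).card

/-- The average of the rewards of the arm `a` observed in the first `t` rounds. -/
def empMean (G : SimpleGraph (Fin K)) (X : ℕ → Ω → Fin K → ℝ) (A : ℕ → Ω → Fin K)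
    (t : ℕ) (ω : Ω) (a : Fin K) : ℝ :=
  (∑ s ∈ obsRounds G A t ω a, X s ω a) / (obsCount G A t ω a : ℝ)

/-- The upper confidence index of the arm `a` after `t` rounds: `+∞` if `a` has not been observed
yet, otherwise the empirical mean plus `√(c log (2 T K / δ) / n)`, with `n` the number of
observations of `a` so far. -/
def ucbIndex (G : SimpleGraph (Fin K)) (T : ℕ) (δ c : ℝ) (X : ℕ → Ω → Fin K → ℝ)
    (A : ℕ → Ω → Fin K) (t : ℕ) (ω : Ω) (a : Fin K) : EReal :=
  if obsCount G A t ω a = 0 then ⊤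
  else ((empMean G X A t ω a
    + Real.sqrt (c * Real.log (2 * T * K / δ) / (obsCount G A t ω a : ℝ)) : ℝ) : EReal)

/-- The interaction protocol over `T` rounds. The reward vectors `X t` have law `P` and are
independent of the past `ℱ t`, which contains all earlier reward vectors (so they are i.i.d.); the
arm `A t` is chosen on the basis of the past `ℱ t`, which may also hold private randomness. -/
structure IsInteraction [mΩ : MeasurableSpace Ω] (ν : Measure Ω) (P : Measure (Fin K → ℝ)) (T : ℕ)
    (ℱ : Filtration ℕ mΩ) (X : ℕ → Ω → Fin K → ℝ) (A : ℕ → Ω → Fin K) : Prop where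
  reward_measurable : ∀ t < T, Measurable[ℱ (t + 1)] (X t)
  reward_law : ∀ t < T, ν.map (X t) = P
  reward_indep : ∀ t < T, Indep (MeasurableSpace.comap (X t) inferInstance) (ℱ t) ν
  arm_measurable : ∀ t < T, Measurable[ℱ t] (A t)

/-- The arms are pulled by UCB-N with horizon `T`, confidence parameter `δ` and radius constant
`c`: in every round an arm of largest index is pulled, with ties broken arbitrarily. -/
def FollowsUCBN (G : SimpleGraph (Fin K)) (T : ℕ) (δ c : ℝ) (X : ℕ → Ω → Fin K → ℝ)
    (A : ℕ → Ω → Fin K) : Prop :=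
  ∀ t < T, ∀ ω : Ω, ∀ b : Fin K,
    ucbIndex G T δ c X A t ω b ≤ ucbIndex G T δ c X A t ω (A t ω)

/-- The pseudo-regret `max_a E[∑_t X_{t,a} - ∑_t X_{t,a_t}]` over `T` rounds. -/
def pseudoRegret [MeasurableSpace Ω] (ν : Measure Ω) (T : ℕ) (X : ℕ → Ω → Fin K → ℝ)
    (A : ℕ → Ω → Fin K) : ℝ :=
  ⨆ a : Fin K, ∫ ω, (∑ t ∈ Finset.range T, X t ω a - ∑ t ∈ Finset.range T, X t ω (A t ω)) ∂ν

open Classical in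
/-- The maximum over the independent sets `I` of `G` of the sum of `1 / Δ_a` over the suboptimal
arms `a` of `I`. -/
def maxIndepInvGap (G : SimpleGraph (Fin K)) (P : Measure (Fin K → ℝ)) : ℝ :=
  ⨆ I : {I : Finset (Fin K) // G.IsIndepSet (I : Set (Fin K))},
    ∑ a ∈ (I : Finset (Fin K)).filter (fun a => 0 < gap P a), 1 / gap P a

end FeedbackBandit

end

/-! Outside an event of probability at most `1/T`, every empirical mean of `n` observations is
within `√(L/(2n))` of the true mean, where `L = log(2KT²)`. The decision to count a round is taken
before its reward is drawn, so Hoeffding's exponential supermartingale applies to the first `n`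
observations of an arm for each fixed `n`. A union bound over arms, `n ≤ T` and two signs then
covers all random counts (`IsInteraction.exists_measure_le_forall_deviation_lt`). On this good event
a pulled arm `a` with `n` earlier observations satisfies `n Δ_a² ≤ M = 9L/2`
(`obsCount_mul_gap_sq_le`).

The rest is deterministic (`sum_weight_le_of_count_mul_sq_le`). Colour the rounds with suboptimal
pulls greedily, two rounds conflicting when their arms are equal or adjacent. A colour class
consists of distinct arms forming an independent set, so it has at most `α` elements and its inverse
gaps sum to at most `J`, the maximum in the theorem. The colour of a round is at most the number of
earlier observations of its arm, so in class `l ≥ 1` each gap is at most `√(M/l)`. The class thus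
costs at most `min (MJ/l) (α√(M/l))`, and class `0` at most `J`. Only colours `l ≤ MJ²` occur and
the two bounds cross at `l = MJ²/α²`. The ratio of these thresholds is `α²`, so the harmonic sum
between them produces `log α` instead of `log T`. -/

/-! ### Greedy colouring of rounds and the total weight of the pulls -/

/-- First-fit colouring: the vertices `0, …, T - 1` are properly coloured so that the colour of `t`
is at most the number of its earlier neighbours. -/
lemma exists_firstFit_coloring (R : ℕ → ℕ → Prop) [DecidableRel R] (T : ℕ) :
    ∃ c : ℕ → ℕ, (∀ t < T, c t ≤ ((Finset.range t).filter fun s => R s t).card) ∧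
      ∀ t < T, ∀ s < t, R s t → c s ≠ c t := by
  induction T with
  | zero => exact ⟨fun _ => 0, by simp, by simp⟩
  | succ T ih =>
    obtain ⟨c, h1, h2⟩ := ih
    set N := (Finset.range T).filter fun s => R s T with hN
    -- Pigeonhole: the earlier neighbours of `T` use at most `N.card` colours, so one of `N.card +
    -- 1` is free.
    obtain ⟨k, hk, hk'⟩ : ∃ k ∈ Finset.range (N.card + 1), k ∉ N.image c := by
      apply Finset.exists_mem_notMem_of_card_lt_card
      have := Finset.card_image_le (s := N) (f := c)
      simp only [Finset.card_range]
      omega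
    refine ⟨Function.update c T k, fun t ht => ?_, fun t ht s hs hR => ?_⟩
    · rcases Nat.lt_succ_iff_lt_or_eq.1 ht with h | rfl
      · rw [Function.update_of_ne h.ne]
        exact h1 t h
      · simp only [Function.update_self]
        simp only [Finset.mem_range] at hk
        rw [← hN]; omega
    · rcases Nat.lt_succ_iff_lt_or_eq.1 ht with h | rfl
      · rw [Function.update_of_ne h.ne, Function.update_of_ne (hs.trans h).ne]
        exact h2 t h s hs hR
      · rw [Function.update_self, Function.update_of_ne hs.ne]
        intro he
        apply hk'
        rw [Finset.mem_image]
        exact ⟨s, by simp [hN, hs, hR], he⟩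

/-- Telescoping of `1/√(n+1) ≤ 2√(n+1) - 2√n`. -/
lemma sum_Ioc_one_div_sqrt_le (n : ℕ) :
    ∑ l ∈ Finset.Ioc 0 n, 1 / √(l : ℝ) ≤ 2 * √(n : ℝ) := by
  induction n with
  | zero => simp
  | succ n ih =>
    rw [← Finset.insert_Ioc_right_eq_Ioc_add_one (Nat.zero_le n), Finset.sum_insert (by simp)]
    have hb : 0 < √((n + 1 : ℕ) : ℝ) := Real.sqrt_pos.2 (by positivity)
    have ha : 0 ≤ √(n : ℝ) := Real.sqrt_nonneg _
    have h1 : √((n + 1 : ℕ) : ℝ) ^ 2 = n + 1 := by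
      rw [Real.sq_sqrt (by positivity)]; push_cast; ring
    have h2 : √(n : ℝ) ^ 2 = n := Real.sq_sqrt (by positivity)
    have h3 : 1 / √((n + 1 : ℕ) : ℝ) ≤ 2 * √((n + 1 : ℕ) : ℝ) - 2 * √(n : ℝ) := by
      rw [div_le_iff₀ hb]
      nlinarith [sq_nonneg (√((n + 1 : ℕ) : ℝ) - √(n : ℝ))]
    linarith

lemma sum_Ioc_one_div_le_log {m n : ℕ} (hm : 1 ≤ m) (hmn : m ≤ n) :
    ∑ l ∈ Finset.Ioc m n, 1 / (l : ℝ) ≤ Real.log (n / m) := by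
  induction n, hmn using Nat.le_induction with
  | base =>
    have : (m : ℝ) ≠ 0 := by positivity
    simp [div_self this]
  | succ n hn ih =>
    have hm0 : (0 : ℝ) < m := by exact_mod_cast hm
    have hn0 : (0 : ℝ) < n := by exact_mod_cast (hm.trans hn)
    rw [← Finset.insert_Ioc_right_eq_Ioc_add_one hn, Finset.sum_insert (by simp)]
    rw [Real.log_div hn0.ne' hm0.ne'] at ih
    rw [Real.log_div (by positivity) hm0.ne']
    have h := Real.log_le_sub_one_of_pos (x := (n : ℝ) / ((n + 1 : ℕ) : ℝ)) (by positivity)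
    rw [Real.log_div hn0.ne' (by positivity)] at h
    have : (n : ℝ) / ((n + 1 : ℕ) : ℝ) - 1 = - (1 / ((n + 1 : ℕ) : ℝ)) := by
      push_cast
      field_simp
      ring
    linarith

/-- The two terms cross at `l = x`. Up to `⌊x⌋` the square-root terms add up to at most `2`; beyond
it the harmonic terms give `1 + log (y/x)`. The `1` pays for the term `⌊x⌋ + 1`, set apart because
`⌊x⌋` may be `0`. -/
lemma sum_Ioc_min_le {x y : ℝ} (hx : 0 < x) (hxy : x ≤ y) :
    ∑ l ∈ Finset.Ioc 0 ⌊y⌋₊, min (1 / (l : ℝ)) (1 / √(x * l)) ≤ 3 + Real.log (y / x) := by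
  have hy : 0 < y := hx.trans_le hxy
  have hlog : 0 ≤ Real.log (y / x) := Real.log_nonneg ((one_le_div hx).2 hxy)
  set m := ⌊x⌋₊
  have hmn : m ≤ ⌊y⌋₊ := Nat.floor_le_floor hxy
  have hsplit : ∑ l ∈ Finset.Ioc 0 ⌊y⌋₊, min (1 / (l : ℝ)) (1 / √(x * l))
      ≤ ∑ l ∈ Finset.Ioc 0 m, 1 / √(x * l) + ∑ l ∈ Finset.Ioc m ⌊y⌋₊, 1 / (l : ℝ) := by
    rw [← Finset.sum_Ioc_consecutive _ (Nat.zero_le m) hmn]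
    exact add_le_add (Finset.sum_le_sum fun _ _ => min_le_right _ _)
      (Finset.sum_le_sum fun _ _ => min_le_left _ _)
  have h1 : ∑ l ∈ Finset.Ioc 0 m, 1 / √(x * l) ≤ 2 := by
    have hs : 0 < √x := Real.sqrt_pos.2 hx
    have he : ∑ l ∈ Finset.Ioc 0 m, 1 / √(x * l)
        = (∑ l ∈ Finset.Ioc 0 m, 1 / √(l : ℝ)) / √x := by
      rw [Finset.sum_div]
      refine Finset.sum_congr rfl fun l _ => ?_
      rw [Real.sqrt_mul hx.le, div_div, mul_comm]
    rw [he, div_le_iff₀ hs]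
    refine (sum_Ioc_one_div_sqrt_le m).trans ?_
    gcongr
    exact Nat.floor_le hx.le
  have h2 : ∑ l ∈ Finset.Ioc m ⌊y⌋₊, 1 / (l : ℝ) ≤ 1 + Real.log (y / x) := by
    rcases hmn.eq_or_lt with h | h
    · rw [← h]
      simp only [Finset.Ioc_self, Finset.sum_empty]
      linarith
    · rw [← Finset.sum_Ioc_consecutive _ (Nat.le_succ m) h]
      have hs : ∑ l ∈ Finset.Ioc m (m + 1), 1 / (l : ℝ) ≤ 1 := by
        rw [← Finset.insert_Ioc_right_eq_Ioc_add_one le_rfl]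
        simp only [Finset.Ioc_self, insert_empty_eq, Finset.sum_singleton]
        rw [div_le_one (by positivity)]
        push_cast
        linarith [(Nat.cast_nonneg m : (0 : ℝ) ≤ m)]
      refine add_le_add hs ((sum_Ioc_one_div_le_log (Nat.le_add_left 1 m) h).trans ?_)
      apply Real.log_le_log
      · have : 0 < ⌊y⌋₊ := lt_of_le_of_lt (Nat.zero_le _) h
        positivity
      · apply div_le_div₀ hy.le (Nat.floor_le hy.le) hx
        push_cast
        exact (Nat.lt_floor_add_one x).le
  linarith

open Classical in
/-- If every vertex `a` of positive weight is pulled only as long as `a` and its neighbours have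
been pulled at most `M / Δ a ^ 2` times, the total weight of the pulls is of order `log α` times the
largest sum of the inverse weights over an independent set. -/
lemma sum_weight_le_of_count_mul_sq_le {V : Type*} [Fintype V] (G : SimpleGraph V) (Δ : V → ℝ)
    (h0 : ∀ a, 0 ≤ Δ a) (h1 : ∀ a, Δ a ≤ 1) {J M : ℝ} (hM : 0 < M)
    (hJ : ∀ I : Finset V, G.IsIndepSet (I : Set V) →
      ∑ a ∈ I.filter (fun a => 0 < Δ a), 1 / Δ a ≤ J)
    (A : ℕ → V) (T : ℕ)
    (hpull : ∀ t < T, 0 < Δ (A t) →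
      (((Finset.range t).filter fun s => A t = A s ∨ G.Adj (A s) (A t)).card : ℝ)
        * Δ (A t) ^ 2 ≤ M) :
    ∑ t ∈ Finset.range T, Δ (A t) ≤ J + M * J * (3 + 2 * Real.log G.indepNum) := by
  have hJ0 : 0 ≤ J := by simpa using hJ ∅ (by simp)
  have hlog : 0 ≤ Real.log G.indepNum := Real.log_natCast_nonneg _
  -- A suboptimal pull makes `J` and the independence number positive, as the divisions below
  -- require.
  obtain hno | ⟨t₀, ht₀, hpos₀⟩ : (∀ t < T, ¬ 0 < Δ (A t)) ∨ ∃ t < T, 0 < Δ (A t) := by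
    by_cases h : ∃ t < T, 0 < Δ (A t)
    · exact Or.inr h
    · push Not at h
      exact Or.inl fun t ht => not_lt.2 (h t ht)
  · have : ∑ t ∈ Finset.range T, Δ (A t) ≤ 0 :=
      Finset.sum_nonpos fun t ht => not_lt.1 (hno t (Finset.mem_range.1 ht))
    have : 0 ≤ M * J * (3 + 2 * Real.log G.indepNum) := by positivity
    linarith
  have hsingle : ∀ a, 0 < Δ a → 1 / Δ a ≤ J := by
    intro a ha
    have := hJ {a} (by simp)
    rwa [Finset.filter_true_of_mem (by simpa using ha), Finset.sum_singleton] at this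
  have hJpos : 0 < J := (one_div_pos.2 hpos₀).trans_le (hsingle _ hpos₀)
  have hα : 1 ≤ G.indepNum := by
    have : G.IsIndepSet (({A t₀} : Finset V) : Set V) := by simp
    simpa using this.card_le_indepNum
  have hα' : (1 : ℝ) ≤ G.indepNum := by exact_mod_cast hα
  obtain ⟨c, hc1, hc2⟩ := exists_firstFit_coloring
    (fun s t => 0 < Δ (A s) ∧ (A t = A s ∨ G.Adj (A s) (A t))) T
  set S := (Finset.range T).filter fun t => 0 < Δ (A t) with hS
  have hcM : ∀ t ∈ S, (c t : ℝ) * Δ (A t) ^ 2 ≤ M := by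
    intro t ht
    simp only [hS, Finset.mem_filter, Finset.mem_range] at ht
    refine le_trans ?_ (hpull t ht.1 ht.2)
    gcongr
    refine (hc1 t ht.1).trans (Finset.card_le_card ?_)
    exact Finset.monotone_filter_right _ (fun s _ hs => hs.2)
  -- Since `1 ≤ J Δ`, the bound `c Δ² ≤ M` forces `c ≤ M J²`: the number of colours is bounded
  -- independently of `T`.
  have hcN : ∀ t ∈ S, c t ∈ Finset.range (⌊M * J ^ 2⌋₊ + 1) := by
    intro t ht
    have hpos : 0 < Δ (A t) := (Finset.mem_filter.1 ht).2
    rw [Finset.mem_range, Nat.lt_succ_iff]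
    apply Nat.le_floor
    have h3 : 1 ≤ J * Δ (A t) := (div_le_iff₀ hpos).1 (hsingle _ hpos)
    calc (c t : ℝ) = c t * 1 := by ring
      _ ≤ c t * (J * Δ (A t)) ^ 2 := by gcongr; nlinarith
      _ = (c t * Δ (A t) ^ 2) * J ^ 2 := by ring
      _ ≤ M * J ^ 2 := by gcongr; exact hcM t ht
  have hinj : ∀ l, Set.InjOn A (S.filter fun t => c t = l : Finset ℕ) := by
    intro l s hs t ht hst
    simp only [hS, Finset.coe_filter, Finset.mem_filter, Finset.mem_range, Set.mem_ofPred_eq]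
      at hs ht
    rcases lt_trichotomy s t with h | h | h
    · exact absurd (hs.2.trans ht.2.symm) (hc2 t ht.1.1 s h ⟨hs.1.2, Or.inl hst.symm⟩)
    · exact h
    · exact absurd (ht.2.trans hs.2.symm) (hc2 s hs.1.1 t h ⟨ht.1.2, Or.inl hst⟩)
  have hind : ∀ l, G.IsIndepSet (((S.filter fun t => c t = l).image A : Finset V) : Set V) := by
    intro l a ha b hb _ hadj
    simp only [hS, Finset.coe_image, Set.mem_image, Finset.coe_filter, Finset.mem_filter,
      Finset.mem_range, Set.mem_ofPred_eq] at ha hb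
    obtain ⟨s, hs, rfl⟩ := ha
    obtain ⟨t, ht, rfl⟩ := hb
    rcases lt_trichotomy s t with h | h | h
    · exact hc2 t ht.1.1 s h ⟨hs.1.2, Or.inr hadj⟩ (hs.2.trans ht.2.symm)
    · subst h; exact G.irrefl hadj
    · exact hc2 s hs.1.1 t h ⟨ht.1.2, Or.inr hadj.symm⟩ (ht.2.trans hs.2.symm)
  have hinv : ∀ l, ∑ t ∈ S.filter (fun t => c t = l), 1 / Δ (A t) ≤ J := by
    intro l
    have := hJ _ (hind l)
    rw [Finset.filter_true_of_mem, Finset.sum_image (hinj l)] at this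
    · exact this
    · intro a ha
      obtain ⟨t, ht, rfl⟩ := Finset.mem_image.1 ha
      exact (Finset.mem_filter.1 (Finset.mem_filter.1 ht).1).2
  have hcard : ∀ l, (((S.filter fun t => c t = l).card : ℕ) : ℝ) ≤ G.indepNum := by
    intro l
    have := (hind l).card_le_indepNum
    rw [Finset.card_image_of_injOn (hinj l)] at this
    exact_mod_cast this
  -- For colour `0` the bound `c Δ² ≤ M` is void; `Δ ≤ 1 ≤ 1/Δ` replaces it.
  have hlayer0 : ∑ t ∈ S.filter (fun t => c t = 0), Δ (A t) ≤ J := by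
    refine le_trans (Finset.sum_le_sum fun t ht => ?_) (hinv 0)
    have hpos : 0 < Δ (A t) := (Finset.mem_filter.1 (Finset.mem_filter.1 ht).1).2
    rw [le_div_iff₀ hpos]
    nlinarith [h1 (A t)]
  -- The colour at which `M J / l` and `α √(M/l)` coincide; the latter equals `M J / √(x l)`.
  set x := M * J ^ 2 / (G.indepNum : ℝ) ^ 2 with hx
  have hx0 : 0 < x := by positivity
  have hxy : x ≤ M * J ^ 2 := div_le_self (by positivity) (one_le_pow₀ hα')
  have hlayer : ∀ l ∈ Finset.Ioc 0 ⌊M * J ^ 2⌋₊, ∑ t ∈ S.filter (fun t => c t = l), Δ (A t)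
      ≤ M * J * min (1 / (l : ℝ)) (1 / √(x * l)) := by
    intro l hl
    have hl0 : (0 : ℝ) < l := by exact_mod_cast (Finset.mem_Ioc.1 hl).1
    have hb : ∀ t ∈ S.filter (fun t => c t = l), 0 < Δ (A t) ∧ l * Δ (A t) ^ 2 ≤ M := by
      intro t ht
      rw [Finset.mem_filter] at ht
      refine ⟨(Finset.mem_filter.1 ht.1).2, ?_⟩
      have := hcM t ht.1
      rwa [ht.2] at this
    rw [mul_min_of_nonneg _ _ (by positivity)]
    apply le_min
    · calc ∑ t ∈ S.filter (fun t => c t = l), Δ (A t)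
          ≤ ∑ t ∈ S.filter (fun t => c t = l), M / l * (1 / Δ (A t)) := by
            refine Finset.sum_le_sum fun t ht => ?_
            obtain ⟨hp, hq⟩ := hb t ht
            rw [mul_one_div, le_div_iff₀ hp, le_div_iff₀ hl0]
            linarith
        _ = M / l * ∑ t ∈ S.filter (fun t => c t = l), 1 / Δ (A t) := by rw [Finset.mul_sum]
        _ ≤ M / l * J := by gcongr; exact hinv l
        _ = M * J * (1 / l) := by ring
    · have hM2 : √M ^ 2 = M := Real.sq_sqrt hM.le
      have hM0 : 0 < √M := Real.sqrt_pos.2 hM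
      have hsl : 0 < √(l : ℝ) := Real.sqrt_pos.2 hl0
      have hsx : √(x * l) = √M * J / G.indepNum * √(l : ℝ) := by
        rw [Real.sqrt_mul hx0.le, hx, Real.sqrt_div (by positivity), Real.sqrt_mul hM.le,
          Real.sqrt_sq hJ0, Real.sqrt_sq (by positivity)]
      calc ∑ t ∈ S.filter (fun t => c t = l), Δ (A t)
          ≤ ∑ t ∈ S.filter (fun t => c t = l), √(M / l) := by
            refine Finset.sum_le_sum fun t ht => Real.le_sqrt_of_sq_le ?_
            rw [le_div_iff₀ hl0]
            linarith [(hb t ht).2]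
        _ = (S.filter fun t => c t = l).card * √(M / l) := by
            rw [Finset.sum_const, nsmul_eq_mul]
        _ ≤ G.indepNum * √(M / l) := by gcongr; exact_mod_cast hcard l
        _ = M * J * (1 / √(x * l)) := by
            rw [hsx, Real.sqrt_div hM.le]
            field_simp
            rw [hM2]
  have hsum : ∑ t ∈ Finset.range T, Δ (A t)
      = ∑ l ∈ Finset.range (⌊M * J ^ 2⌋₊ + 1), ∑ t ∈ S.filter (fun t => c t = l), Δ (A t) := by
    rw [Finset.sum_fiberwise_of_maps_to hcN]
    symm
    apply Finset.sum_subset (Finset.filter_subset _ _)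
    intro t ht ht'
    refine le_antisymm (not_lt.1 fun h => ht' ?_) (h0 _)
    exact Finset.mem_filter.2 ⟨ht, h⟩
  have hrange : Finset.range (⌊M * J ^ 2⌋₊ + 1) = insert 0 (Finset.Ioc 0 ⌊M * J ^ 2⌋₊) := by
    ext k
    simp only [Finset.mem_range, Finset.mem_insert, Finset.mem_Ioc]
    omega
  rw [hsum, hrange, Finset.sum_insert (by simp)]
  refine add_le_add hlayer0 ((Finset.sum_le_sum hlayer).trans ?_)
  rw [← Finset.mul_sum]
  have hyx : M * J ^ 2 / x = (G.indepNum : ℝ) ^ 2 := by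
    rw [hx]
    field_simp
  have := sum_Ioc_min_le hx0 hxy
  rw [hyx, Real.log_pow] at this
  push_cast at this
  gcongr

/-! ### Hoeffding's inequality under predictable selection -/

lemma lintegral_exp_mul_sub_mean_le {Ω : Type*} [MeasurableSpace Ω] {ν : Measure Ω}
    [IsProbabilityMeasure ν] {Y : Ω → ℝ} (hm : AEMeasurable Y ν)
    (hb : ∀ᵐ ω ∂ν, Y ω ∈ Set.Icc (0 : ℝ) 1) (u : ℝ) :
    ∫⁻ ω, ENNReal.ofReal (Real.exp (u * (Y ω - ∫ ω', Y ω' ∂ν))) ∂ν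
      ≤ ENNReal.ofReal (Real.exp (u ^ 2 / 8)) := by
  have h := hasSubgaussianMGF_of_mem_Icc hm hb
  rw [← ofReal_integral_eq_lintegral_ofReal (h.integrable_exp_mul u)
    (Filter.Eventually.of_forall fun _ => (Real.exp_pos _).le)]
  apply ENNReal.ofReal_le_ofReal
  refine (h.mgf_le u).trans (le_of_eq ?_)
  congr 1
  push_cast
  norm_num
  ring

section PredictableSelection

variable {Ω : Type*} [mΩ : MeasurableSpace Ω] {ν : Measure Ω} [IsProbabilityMeasure ν]
  {ℱ : Filtration ℕ mΩ} {Y : ℕ → Ω → ℝ} {E : ℕ → Set Ω} {T : ℕ}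

/-- The exponential supermartingale of the increments `Y s` selected by predictable events. -/
lemma lintegral_exp_sum_indicator_le_one
    (hE : ∀ s < T, MeasurableSet[ℱ s] (E s)) (hY : ∀ s < T, Measurable[ℱ (s + 1)] (Y s))
    (hind : ∀ s < T, Indep (MeasurableSpace.comap (Y s) inferInstance) (ℱ s) ν) (u v : ℝ)
    (hmgf : ∀ s < T, ∫⁻ ω, ENNReal.ofReal (Real.exp (u * Y s ω)) ∂ν
      ≤ ENNReal.ofReal (Real.exp v)) :
    ∀ t ≤ T, (Measurable[ℱ t] fun ω => ENNReal.ofReal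
        (Real.exp (∑ s ∈ Finset.range t, (E s).indicator (fun ω => u * Y s ω - v) ω))) ∧
      ∫⁻ ω, ENNReal.ofReal
        (Real.exp (∑ s ∈ Finset.range t, (E s).indicator (fun ω => u * Y s ω - v) ω)) ∂ν ≤ 1 := by
  intro t
  induction t with
  | zero => exact fun _ => ⟨by simp, by simp⟩
  | succ t ih =>
    intro ht
    obtain ⟨hWm, hW⟩ := ih (by omega)
    set W : Ω → ENNReal := fun ω => ENNReal.ofReal
        (Real.exp (∑ s ∈ Finset.range t, (E s).indicator (fun ω => u * Y s ω - v) ω)) with hWdef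
    set Z : Ω → ENNReal := fun ω => ENNReal.ofReal (Real.exp (u * Y t ω - v)) with hZdef
    have hmul : ∀ ω, ENNReal.ofReal (Real.exp (∑ s ∈ Finset.range (t + 1),
          (E s).indicator (fun ω => u * Y s ω - v) ω))
        = (E t)ᶜ.indicator W ω + (E t).indicator W ω * Z ω := by
      intro ω
      rw [Finset.sum_range_succ, Real.exp_add, ENNReal.ofReal_mul (Real.exp_pos _).le]
      by_cases h : ω ∈ E t <;> simp [h, hWdef, hZdef]
    have hEt := hE t ht
    have hEt' : MeasurableSet[ℱ (t + 1)] (E t) := ℱ.mono (Nat.le_succ t) _ hEt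
    have hWm' : Measurable[ℱ (t + 1)] W := hWm.mono (ℱ.mono (Nat.le_succ t)) le_rfl
    have hWi : Measurable[ℱ t] ((E t).indicator W) := hWm.indicator hEt
    have hWic : Measurable[ℱ t] ((E t)ᶜ.indicator W) := hWm.indicator hEt.compl
    have hexp : Measurable fun y : ℝ => ENNReal.ofReal (Real.exp (u * y - v)) := by fun_prop
    have hZc : Measurable[MeasurableSpace.comap (Y t) inferInstance] Z :=
      hexp.comp (comap_measurable (Y t))
    have hZm : Measurable[ℱ (t + 1)] Z := hexp.comp (hY t ht)
    simp only [hmul]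
    refine ⟨Measurable.add (hWic.mono (ℱ.mono (Nat.le_succ t)) le_rfl)
      ((hWi.mono (ℱ.mono (Nat.le_succ t)) le_rfl).mul hZm), ?_⟩
    have hZ1 : ∫⁻ ω, Z ω ∂ν ≤ 1 := by
      have : ∀ ω, Z ω = ENNReal.ofReal (Real.exp (-v)) * ENNReal.ofReal (Real.exp (u * Y t ω)) := by
        intro ω
        rw [← ENNReal.ofReal_mul (Real.exp_pos _).le, ← Real.exp_add]
        simp only [hZdef]
        congr 2
        ring
      simp only [this]
      rw [lintegral_const_mul' _ _ ENNReal.ofReal_ne_top]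
      calc _ ≤ ENNReal.ofReal (Real.exp (-v)) * ENNReal.ofReal (Real.exp v) := by
            gcongr
            exact hmgf t ht
        _ = 1 := by
            rw [← ENNReal.ofReal_mul (Real.exp_pos _).le, ← Real.exp_add]
            simp
    rw [lintegral_add_left (hWic.mono (ℱ.le t) le_rfl)]
    -- The selected part of `W` is known at time `t` while `Z` depends on `Y t` alone, so the
    -- integral factorizes.
    rw [lintegral_mul_eq_lintegral_mul_lintegral_of_independent_measurableSpace (ℱ.le t)
      (((hY t ht).mono (ℱ.le _) le_rfl).comap_le) (hind t ht).symm hWi hZc]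
    calc _ ≤ ∫⁻ ω, (E t)ᶜ.indicator W ω ∂ν + (∫⁻ ω, (E t).indicator W ω ∂ν) * 1 := by gcongr
      _ = ∫⁻ ω, W ω ∂ν := by
          rw [mul_one, ← lintegral_add_left (hWic.mono (ℱ.le t) le_rfl)]
          congr 1 with ω
          by_cases h : ω ∈ E t <;> simp [h]
      _ ≤ 1 := hW

open Classical in
/-- Hoeffding's inequality for a predictable selection of at most `n` increments. -/
lemma measure_sum_selected_ge_le
    (hE : ∀ s < T, MeasurableSet[ℱ s] (E s)) (hY : ∀ s < T, Measurable[ℱ (s + 1)] (Y s))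
    (hind : ∀ s < T, Indep (MeasurableSpace.comap (Y s) inferInstance) (ℱ s) ν)
    (hmgf : ∀ s < T, ∀ u : ℝ, ∫⁻ ω, ENNReal.ofReal (Real.exp (u * Y s ω)) ∂ν
      ≤ ENNReal.ofReal (Real.exp (u ^ 2 / 8)))
    {n : ℕ} (hn : 0 < n) (hcard : ∀ ω, ((Finset.range T).filter fun s => ω ∈ E s).card ≤ n)
    {L : ℝ} (hL : 0 ≤ L) :
    ν {ω | √(n * L / 2) ≤ ∑ s ∈ (Finset.range T).filter (fun s => ω ∈ E s), Y s ω}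
      ≤ ENNReal.ofReal (Real.exp (-L)) := by
  have hn0 : (0 : ℝ) < n := by exact_mod_cast hn
  set r := √(n * L / 2) with hr
  have hr2 : r ^ 2 = n * L / 2 := Real.sq_sqrt (by positivity)
  -- The maximizer of `u r - n u²/8`; the maximum `2 r²/n` is exactly `L`.
  set u := 4 * r / n with hu
  have hu0 : 0 ≤ u := by positivity
  obtain ⟨hm, h1⟩ := lintegral_exp_sum_indicator_le_one hE hY hind u (u ^ 2 / 8)
    (fun s hs => hmgf s hs u) T le_rfl
  set W : Ω → ENNReal := fun ω => ENNReal.ofReal (Real.exp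
    (∑ s ∈ Finset.range T, (E s).indicator (fun ω => u * Y s ω - u ^ 2 / 8) ω)) with hW
  have hsub : {ω | r ≤ ∑ s ∈ (Finset.range T).filter (fun s => ω ∈ E s), Y s ω}
      ⊆ {ω | ENNReal.ofReal (Real.exp L) ≤ W ω} := by
    intro ω hω
    simp only [Set.mem_ofPred_eq] at hω ⊢
    apply ENNReal.ofReal_le_ofReal
    apply Real.exp_le_exp.2
    have he : ∑ s ∈ Finset.range T, (E s).indicator (fun ω => u * Y s ω - u ^ 2 / 8) ω
        = u * ∑ s ∈ (Finset.range T).filter (fun s => ω ∈ E s), Y s ω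
          - ((Finset.range T).filter fun s => ω ∈ E s).card * (u ^ 2 / 8) := by
      simp only [Set.indicator_apply]
      rw [← Finset.sum_filter, Finset.sum_sub_distrib, ← Finset.mul_sum, Finset.sum_const,
        nsmul_eq_mul]
    rw [he]
    have hc : (((Finset.range T).filter fun s => ω ∈ E s).card : ℝ) ≤ n := by
      exact_mod_cast hcard ω
    calc L = u * r - n * (u ^ 2 / 8) := by
          rw [hu]
          field_simp
          rw [hr2]
          ring
      _ ≤ _ := by gcongr
  have hpos : ENNReal.ofReal (Real.exp L) ≠ 0 := by simp [Real.exp_pos]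
  calc _ ≤ ν {ω | ENNReal.ofReal (Real.exp L) ≤ W ω} := measure_mono hsub
    _ ≤ (∫⁻ ω, W ω ∂ν) / ENNReal.ofReal (Real.exp L) :=
        meas_ge_le_lintegral_div (hm.mono (ℱ.le T) le_rfl).aemeasurable hpos ENNReal.ofReal_ne_top
    _ ≤ 1 / ENNReal.ofReal (Real.exp L) := by gcongr
    _ = ENNReal.ofReal (Real.exp (-L)) := by
        rw [one_div, Real.exp_neg, ENNReal.ofReal_inv_of_pos (Real.exp_pos _)]

end PredictableSelection

namespace FeedbackBandit

/-! ### Observation counts and their predictability -/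

section Counting

variable {K : ℕ} {Ω : Type*} (G : SimpleGraph (Fin K)) (A : ℕ → Ω → Fin K)

lemma obsCount_mono {s t : ℕ} (h : s ≤ t) (ω : Ω) (a : Fin K) :
    obsCount G A s ω a ≤ obsCount G A t ω a := by
  classical
  exact Finset.card_le_card (Finset.filter_subset_filter _ (Finset.range_mono h))

open Classical in
lemma obsCount_succ (t : ℕ) (ω : Ω) (a : Fin K) :
    obsCount G A (t + 1) ω a = obsCount G A t ω a + if Observes G (A t ω) a then 1 else 0 := by
  simp only [obsCount, obsRounds, Finset.card_filter, Finset.sum_range_succ]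

/-- Round `s` yields one of the first `n` observations of `a`. -/
def firstObs (a : Fin K) (n s : ℕ) : Set Ω :=
  {ω | Observes G (A s ω) a ∧ obsCount G A s ω a < n}

open Classical in
lemma card_firstObs_le (a : Fin K) (n T : ℕ) (ω : Ω) :
    ((Finset.range T).filter fun s => ω ∈ firstObs G A a n s).card ≤ n := by
  -- The minimum with the count makes the induction close: it records that selection stops once `n`
  -- is reached.
  suffices h : ((Finset.range T).filter fun s => ω ∈ firstObs G A a n s).card ≤
      min n (obsCount G A T ω a) from h.trans (min_le_left _ _)
  induction T with
  | zero => simp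
  | succ T ih =>
    rw [Finset.card_filter, Finset.sum_range_succ, ← Finset.card_filter, obsCount_succ]
    by_cases h1 : Observes G (A T ω) a <;> by_cases h2 : obsCount G A T ω a < n <;>
      simp only [firstObs, Set.mem_ofPred_eq, h1, h2, and_self, and_true, and_false, if_true,
        if_false] at ih ⊢ <;> omega

-- Turns a random number of observations into a fixed one: on the event that the count at time `t`
-- is `n`, the first `n` observations are exactly those made before `t`. This is what permits a
-- union bound over `n`.
open Classical in
lemma filter_firstObs_eq_obsRounds {t T : ℕ} (ht : t ≤ T) (ω : Ω) (a : Fin K) :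
    ((Finset.range T).filter fun s => ω ∈ firstObs G A a (obsCount G A t ω a) s)
      = obsRounds G A t ω a := by
  ext s
  rw [obsRounds, Finset.mem_filter, Finset.mem_filter, Finset.mem_range, Finset.mem_range]
  constructor
  · rintro ⟨_, ho, hlt⟩
    refine ⟨?_, ho⟩
    by_contra hs
    exact absurd (obsCount_mono G A (not_lt.1 hs) ω a) (not_le.2 hlt)
  · rintro ⟨hs, ho⟩
    refine ⟨hs.trans_le ht, ho, ?_⟩
    refine lt_of_lt_of_le ?_ (obsCount_mono G A (Nat.succ_le_of_lt hs) ω a)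
    simp [obsCount_succ, ho]

lemma measurable_obsCount [mΩ : MeasurableSpace Ω] {ℱ : Filtration ℕ mΩ} {T : ℕ}
    (hA : ∀ s < T, Measurable[ℱ s] (A s)) {t : ℕ} (ht : t ≤ T) (a : Fin K) :
    Measurable[ℱ t] fun ω => obsCount G A t ω a := by
  classical
  simp only [obsCount, obsRounds, Finset.card_filter]
  refine Finset.measurable_sum _ fun s hs => ?_
  have hs' := Finset.mem_range.1 hs
  have := (hA s (hs'.trans_le ht)).mono (ℱ.mono hs'.le) le_rfl
  exact (measurable_of_finite fun b => if Observes G b a then 1 else 0).comp this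

/-- Selection of round `s` is decided by the arms pulled up to and including `s`, hence before the
reward of round `s` is drawn. -/
lemma measurableSet_firstObs [mΩ : MeasurableSpace Ω] {ℱ : Filtration ℕ mΩ} {T : ℕ}
    (hA : ∀ s < T, Measurable[ℱ s] (A s)) (a : Fin K) (n : ℕ) {s : ℕ} (hs : s < T) :
    MeasurableSet[ℱ s] (firstObs G A a n s) :=
  MeasurableSet.inter (hA s hs (Set.toFinite {b | Observes G b a}).measurableSet)
    (measurable_obsCount G A hA hs.le a (Set.toFinite (Set.Iio n)).measurableSet)

end Counting

/-! ### Range of the gaps -/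

section Gap

variable {K : ℕ} {P : Measure (Fin K → ℝ)}

lemma armMean_le_iSup (a : Fin K) : armMean P a ≤ ⨆ b, armMean P b :=
  le_ciSup (Set.finite_range _).bddAbove a

lemma gap_nonneg (a : Fin K) : 0 ≤ gap P a := sub_nonneg.2 (armMean_le_iSup a)

lemma armMean_mem_Icc [IsProbabilityMeasure P] (hP : ∀ᵐ x ∂P, ∀ a, x a ∈ Set.Icc (0 : ℝ) 1)
    (a : Fin K) : armMean P a ∈ Set.Icc (0 : ℝ) 1 := by
  constructor
  · exact integral_nonneg_of_ae (hP.mono fun x hx => (hx a).1)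
  · have := integral_mono_of_nonneg (hP.mono fun x hx => (hx a).1) (integrable_const (1 : ℝ))
      (hP.mono fun x hx => (hx a).2)
    unfold armMean
    simpa using this

lemma gap_le_one [IsProbabilityMeasure P] (hP : ∀ᵐ x ∂P, ∀ a, x a ∈ Set.Icc (0 : ℝ) 1)
    (a : Fin K) : gap P a ≤ 1 := by
  have : Nonempty (Fin K) := ⟨a⟩
  have h1 : (⨆ b, armMean P b) ≤ 1 := ciSup_le fun b => (armMean_mem_Icc hP b).2
  have h2 := (armMean_mem_Icc hP a).1
  unfold gap
  linarith

open Classical in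
lemma sum_inv_gap_le_maxIndepInvGap (G : SimpleGraph (Fin K)) {I : Finset (Fin K)}
    (hI : G.IsIndepSet (I : Set (Fin K))) :
    ∑ a ∈ I.filter (fun a => 0 < gap P a), 1 / gap P a ≤ maxIndepInvGap G P :=
  le_ciSup (f := fun I : {I : Finset (Fin K) // G.IsIndepSet (I : Set (Fin K))} =>
    ∑ a ∈ (I : Finset (Fin K)).filter (fun a => 0 < gap P a), 1 / gap P a)
    (Set.finite_range _).bddAbove ⟨I, hI⟩

end Gap

/-! ### The good event -/

section Concentration

variable {K : ℕ} {Ω : Type*} [mΩ : MeasurableSpace Ω] {ν : Measure Ω}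
  {P : Measure (Fin K → ℝ)} {T : ℕ} {ℱ : Filtration ℕ mΩ} {X : ℕ → Ω → Fin K → ℝ}
  {A : ℕ → Ω → Fin K}

lemma IsInteraction.measurable_reward (h : IsInteraction ν P T ℱ X A) {t : ℕ} (ht : t < T) :
    Measurable (X t) := (h.reward_measurable t ht).mono (ℱ.le _) le_rfl

lemma IsInteraction.measurable_arm (h : IsInteraction ν P T ℱ X A) {t : ℕ} (ht : t < T) :
    Measurable (A t) := (h.arm_measurable t ht).mono (ℱ.le _) le_rfl

lemma IsInteraction.ae_mem_Icc (h : IsInteraction ν P T ℱ X A)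
    (hP : ∀ᵐ x ∂P, ∀ a, x a ∈ Set.Icc (0 : ℝ) 1) {t : ℕ} (ht : t < T) :
    ∀ᵐ ω ∂ν, ∀ a, X t ω a ∈ Set.Icc (0 : ℝ) 1 := by
  rw [← h.reward_law t ht] at hP
  exact ae_of_ae_map (h.measurable_reward ht).aemeasurable hP

lemma IsInteraction.integral_reward (h : IsInteraction ν P T ℱ X A) {t : ℕ} (ht : t < T)
    (a : Fin K) : ∫ ω, X t ω a ∂ν = armMean P a := by
  rw [armMean, ← h.reward_law t ht, integral_map (h.measurable_reward ht).aemeasurable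
    (measurable_pi_apply a).aestronglyMeasurable]

variable [IsProbabilityMeasure ν]

open Classical in
/-- The deviation of a signed sum of the first `n` observations of an arm. -/
lemma IsInteraction.measure_deviation_le (h : IsInteraction ν P T ℱ X A) (G : SimpleGraph (Fin K))
    (hP : ∀ᵐ x ∂P, ∀ a, x a ∈ Set.Icc (0 : ℝ) 1) (a : Fin K) {n : ℕ} (hn : 0 < n)
    {L : ℝ} (hL : 0 ≤ L) {σ : ℝ} (hσ : σ ^ 2 = 1) :
    ν {ω | √(n * L / 2) ≤ ∑ s ∈ (Finset.range T).filter (fun s => ω ∈ firstObs G A a n s),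
        σ * (X s ω a - armMean P a)} ≤ ENNReal.ofReal (Real.exp (-L)) := by
  have hf : Measurable fun x : Fin K → ℝ => σ * (x a - armMean P a) := by fun_prop
  refine measure_sum_selected_ge_le (Y := fun s ω => σ * (X s ω a - armMean P a))
    (fun s hs => measurableSet_firstObs G A h.arm_measurable a n hs)
    (fun s hs => hf.comp (h.reward_measurable s hs)) (fun s hs => ?_) (fun s hs u => ?_) hn
    (card_firstObs_le G A a n T) hL
  · refine indep_of_indep_of_le_left (h.reward_indep s hs) ?_
    exact (hf.comp (comap_measurable (X s))).comap_le
  · have := lintegral_exp_mul_sub_mean_le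
      (((measurable_pi_apply a).comp (h.measurable_reward hs)).aemeasurable (μ := ν))
      ((h.ae_mem_Icc hP hs).mono fun ω hω => hω a) (u * σ)
    simp only [Function.comp_apply, h.integral_reward hs, mul_pow, hσ, mul_one, mul_assoc] at this
    exact this

/-- With probability at least `1 - 2 K T exp (-L)` all empirical sums are close to their means. -/
lemma IsInteraction.exists_measure_le_forall_deviation_lt (h : IsInteraction ν P T ℱ X A)
    (G : SimpleGraph (Fin K)) (hP : ∀ᵐ x ∂P, ∀ a, x a ∈ Set.Icc (0 : ℝ) 1)
    {L : ℝ} (hL : 0 ≤ L) :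
    ∃ B : Set Ω, MeasurableSet B ∧ ν.real B ≤ 2 * K * T * Real.exp (-L) ∧
      ∀ ω ∉ B, ∀ t ≤ T, ∀ a, 0 < obsCount G A t ω a →
        |∑ s ∈ obsRounds G A t ω a, (X s ω a - armMean P a)| < √(obsCount G A t ω a * L / 2) := by
  classical
  set D : ℝ → Fin K → ℕ → Set Ω := fun σ a n =>
    {ω | √(n * L / 2) ≤ ∑ s ∈ (Finset.range T).filter (fun s => ω ∈ firstObs G A a n s),
        σ * (X s ω a - armMean P a)} with hD
  set B₀ : Set Ω := ⋃ p ∈ (Finset.univ : Finset (Fin K)) ×ˢ Finset.Icc 1 T,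
    (D 1 p.1 p.2 ∪ D (-1) p.1 p.2) with hB₀
  have hB : ν B₀ ≤ ENNReal.ofReal (2 * K * T * Real.exp (-L)) := by
    calc ν B₀ ≤ ∑ p ∈ (Finset.univ : Finset (Fin K)) ×ˢ Finset.Icc 1 T,
          ν (D 1 p.1 p.2 ∪ D (-1) p.1 p.2) := measure_biUnion_finset_le _ _
      _ ≤ ∑ p ∈ (Finset.univ : Finset (Fin K)) ×ˢ Finset.Icc 1 T,
          ENNReal.ofReal (2 * Real.exp (-L)) := by
          refine Finset.sum_le_sum fun p hp => ?_
          have hp1 : 0 < p.2 := (Finset.mem_Icc.1 (Finset.mem_product.1 hp).2).1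
          rw [two_mul, ENNReal.ofReal_add (Real.exp_pos _).le (Real.exp_pos _).le]
          exact (measure_union_le _ _).trans (add_le_add
            (h.measure_deviation_le G hP p.1 hp1 hL (by norm_num))
            (h.measure_deviation_le G hP p.1 hp1 hL (by norm_num)))
      _ = ENNReal.ofReal (2 * K * T * Real.exp (-L)) := by
          rw [Finset.sum_const, nsmul_eq_mul, ← ENNReal.ofReal_natCast,
            ← ENNReal.ofReal_mul (by positivity)]
          congr 1
          simp
          ring
  -- A measurable hull has the same measure and contains `B₀`, so measurability of the deviation
  -- events need not be checked.
  refine ⟨toMeasurable ν B₀, measurableSet_toMeasurable _ _, ?_, fun ω hω t ht a hn => ?_⟩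
  · rw [Measure.real, measure_toMeasurable]
    exact ENNReal.toReal_le_of_le_ofReal (by positivity) hB
  · have hω' : ω ∉ B₀ := fun h' => hω (subset_toMeasurable _ _ h')
    have hnT : obsCount G A t ω a ≤ T := by
      refine (Finset.card_le_card (Finset.filter_subset _ _)).trans ?_
      simpa using ht
    simp only [hB₀, Set.mem_iUnion, not_exists] at hω'
    have h2 := hω' (a, obsCount G A t ω a)
      (Finset.mem_product.2 ⟨Finset.mem_univ _, Finset.mem_Icc.2 ⟨hn, hnT⟩⟩)
    simp only [hD, Set.mem_union, Set.mem_ofPred_eq, not_or, not_le,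
      filter_firstObs_eq_obsRounds G A ht, ← Finset.mul_sum] at h2
    rw [abs_lt]
    constructor <;> linarith [h2.1, h2.2]

end Concentration

/-! ### Observation count of an arm of largest index -/

section Index

variable {K : ℕ} {Ω : Type*} {P : Measure (Fin K → ℝ)} {T : ℕ} {X : ℕ → Ω → Fin K → ℝ}
  {A : ℕ → Ω → Fin K} {G : SimpleGraph (Fin K)}

lemma abs_empMean_sub_armMean_lt {t : ℕ} {ω : Ω} {a : Fin K} {L : ℝ}
    (hn : 0 < obsCount G A t ω a)
    (h : |∑ s ∈ obsRounds G A t ω a, (X s ω a - armMean P a)| < √(obsCount G A t ω a * L / 2)) :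
    |empMean G X A t ω a - armMean P a| < √(L / 2 / obsCount G A t ω a) := by
  have hn0 : (0 : ℝ) < obsCount G A t ω a := by exact_mod_cast hn
  have h1 : empMean G X A t ω a - armMean P a
      = (∑ s ∈ obsRounds G A t ω a, (X s ω a - armMean P a)) / obsCount G A t ω a := by
    rw [Finset.sum_sub_distrib, Finset.sum_const, nsmul_eq_mul, empMean, sub_div]
    change _ = _ - (obsCount G A t ω a : ℝ) * _ / _
    rw [mul_div_cancel_left₀ _ hn0.ne']
  have h2 : √(L / 2 / obsCount G A t ω a)
      = √(obsCount G A t ω a * L / 2) / obsCount G A t ω a := by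
    rw [eq_div_iff hn0.ne']
    nth_rewrite 2 [← Real.sqrt_sq hn0.le]
    rw [← Real.sqrt_mul' _ (by positivity)]
    congr 1
    field_simp
  rw [h1, abs_div, abs_of_pos hn0, h2]
  exact div_lt_div_of_pos_right h hn0

/-- If the empirical means are accurate, an arm of largest index has been observed at most
`9 L / (2 Δ ^ 2)` times. -/
lemma obsCount_mul_gap_sq_le {δ c : ℝ} (hc : c ∈ Set.Icc (1 / 2 : ℝ) 2)
    (hL : 0 ≤ Real.log (2 * T * K / δ)) {t : ℕ} {ω : Ω} {a : Fin K}
    (hgood : ∀ b, 0 < obsCount G A t ω b →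
      |∑ s ∈ obsRounds G A t ω b, (X s ω b - armMean P b)|
        < √(obsCount G A t ω b * Real.log (2 * T * K / δ) / 2))
    (hmax : ∀ b, ucbIndex G T δ c X A t ω b ≤ ucbIndex G T δ c X A t ω a) :
    (obsCount G A t ω a : ℝ) * gap P a ^ 2 ≤ 9 / 2 * Real.log (2 * T * K / δ) := by
  set L := Real.log (2 * T * K / δ) with hLdef
  rcases Nat.eq_zero_or_pos (obsCount G A t ω a) with hn | hn
  · rw [hn]
    simp only [CharP.cast_eq_zero, zero_mul]
    positivity
  have : Nonempty (Fin K) := ⟨a⟩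
  obtain ⟨b, hb⟩ := exists_eq_ciSup_of_finite (f := armMean P)
  have hle := hmax b
  -- An unobserved optimal arm `b` would have index `⊤`, above the finite index of `a`.
  have hm : 0 < obsCount G A t ω b := by
    by_contra hm
    rw [ucbIndex, ucbIndex, if_pos (by omega), if_neg (by omega)] at hle
    exact absurd hle (not_le.2 (EReal.coe_lt_top _))
  rw [ucbIndex, ucbIndex, if_neg hm.ne', if_neg hn.ne', EReal.coe_le_coe_iff, ← hLdef] at hle
  have hm0 : (0 : ℝ) < obsCount G A t ω b := by exact_mod_cast hm
  have hn0 : (0 : ℝ) < obsCount G A t ω a := by exact_mod_cast hn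
  have hA := (abs_lt.1 (abs_empMean_sub_armMean_lt hn (hgood a hn))).2
  have hB := (abs_lt.1 (abs_empMean_sub_armMean_lt hm (hgood b hm))).1
  -- `c ≥ 1/2` makes the index of `b` at least its mean; below, `c ≤ 2` bounds the radius of `a` by
  -- twice its deviation. Together with the deviation of `a` itself this gives the factor `3`, hence
  -- `9/2`.
  have h1 : √(L / 2 / obsCount G A t ω b) ≤ √(c * L / obsCount G A t ω b) := by
    apply Real.sqrt_le_sqrt
    gcongr
    nlinarith [hc.1]
  have h2 : √(c * L / obsCount G A t ω a) ≤ 2 * √(L / 2 / obsCount G A t ω a) := by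
    apply Real.sqrt_le_iff.2 ⟨by positivity, ?_⟩
    rw [mul_pow, Real.sq_sqrt (by positivity), mul_div_assoc']
    refine div_le_div_of_nonneg_right ?_ hn0.le
    nlinarith [hc.2]
  have h3 : gap P a ≤ 3 * √(L / 2 / obsCount G A t ω a) := by
    rw [gap, ← hb]
    linarith
  have h4 := pow_le_pow_left₀ (gap_nonneg a) h3 2
  rw [mul_pow, Real.sq_sqrt (by positivity)] at h4
  calc (obsCount G A t ω a : ℝ) * gap P a ^ 2
      ≤ obsCount G A t ω a * (3 ^ 2 * (L / 2 / obsCount G A t ω a)) := by gcongr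
    _ = 9 / 2 * L := by
      field_simp
      ring

end Index

/-! ### From pseudo-regret to expected gaps -/

/-- Splitting by the pulled arm leaves fixed coordinates on events of the past, to which
independence applies. -/
lemma reward_arm_eq_sum_indicator {K : ℕ} {Ω : Type*} (X : ℕ → Ω → Fin K → ℝ) (A : ℕ → Ω → Fin K)
    (t : ℕ) :
    (fun ω => X t ω (A t ω)) = fun ω => ∑ b, (A t ⁻¹' {b}).indicator (fun ω => X t ω b) ω := by
  classical
  ext ω
  simp [Set.indicator_apply]

section Regret

variable {K : ℕ} {Ω : Type*} [mΩ : MeasurableSpace Ω] {ν : Measure Ω} [IsProbabilityMeasure ν]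
  {P : Measure (Fin K → ℝ)} {T : ℕ} {ℱ : Filtration ℕ mΩ} {X : ℕ → Ω → Fin K → ℝ}
  {A : ℕ → Ω → Fin K}

lemma IsInteraction.integrable_reward (h : IsInteraction ν P T ℱ X A)
    (hP : ∀ᵐ x ∂P, ∀ a, x a ∈ Set.Icc (0 : ℝ) 1) {t : ℕ} (ht : t < T) (a : Fin K) :
    Integrable (fun ω => X t ω a) ν :=
  Integrable.of_mem_Icc 0 1 (((measurable_pi_apply a).comp (h.measurable_reward ht)).aemeasurable)
    ((h.ae_mem_Icc hP ht).mono fun _ hω => hω a)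

lemma IsInteraction.integrable_reward_arm (h : IsInteraction ν P T ℱ X A)
    (hP : ∀ᵐ x ∂P, ∀ a, x a ∈ Set.Icc (0 : ℝ) 1) {t : ℕ} (ht : t < T) :
    Integrable (fun ω => X t ω (A t ω)) ν := by
  rw [reward_arm_eq_sum_indicator]
  exact integrable_finsetSum _ fun b _ =>
    (h.integrable_reward hP ht b).indicator (h.measurable_arm ht (measurableSet_singleton b))

lemma IsInteraction.integrable_comp_arm (h : IsInteraction ν P T ℱ X A) (f : Fin K → ℝ)
    {t : ℕ} (ht : t < T) : Integrable (fun ω => f (A t ω)) ν := by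
  obtain ⟨C, hC⟩ := (Set.finite_range fun b => ‖f b‖).bddAbove
  refine Integrable.of_bound
    ((measurable_of_finite f).comp (h.measurable_arm ht)).aestronglyMeasurable C ?_
  exact Filter.Eventually.of_forall fun ω => hC ⟨A t ω, rfl⟩

/-- The reward of a round is independent of the arm, so that its mean is the mean of the arm. -/
lemma IsInteraction.integral_reward_arm (h : IsInteraction ν P T ℱ X A)
    (hP : ∀ᵐ x ∂P, ∀ a, x a ∈ Set.Icc (0 : ℝ) 1) {t : ℕ} (ht : t < T) :
    ∫ ω, X t ω (A t ω) ∂ν = ∫ ω, armMean P (A t ω) ∂ν := by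
  classical
  have hmeas : ∀ b, MeasurableSet (A t ⁻¹' {b}) := fun b =>
    h.measurable_arm ht (measurableSet_singleton b)
  have hr : (fun ω => armMean P (A t ω))
      = fun ω => ∑ b, (A t ⁻¹' {b}).indicator (fun _ => armMean P b) ω := by
    ext ω
    simp [Set.indicator_apply]
  rw [reward_arm_eq_sum_indicator, hr, integral_finsetSum _ fun b _ =>
    (h.integrable_reward hP ht b).indicator (hmeas b), integral_finsetSum _ fun b _ =>
    (integrable_const _).indicator (hmeas b)]
  refine Finset.sum_congr rfl fun b _ => ?_
  rw [integral_indicator (hmeas b), integral_indicator_const _ (hmeas b), smul_eq_mul,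
    Indep.setIntegral_eq_mul (ℱ.le t) (f := fun x : Fin K → ℝ => x b) (h.reward_indep t ht).symm
      (h.measurable_reward ht).aemeasurable
      (h.arm_measurable t ht (measurableSet_singleton b))
      (measurable_pi_apply b).aestronglyMeasurable, h.integral_reward ht]

/-- The pseudo-regret is at most the expected sum of the gaps of the pulled arms. -/
lemma IsInteraction.pseudoRegret_le [NeZero K] (h : IsInteraction ν P T ℱ X A)
    (hP : ∀ᵐ x ∂P, ∀ a, x a ∈ Set.Icc (0 : ℝ) 1) :
    pseudoRegret ν T X A ≤ ∫ ω, ∑ t ∈ Finset.range T, gap P (A t ω) ∂ν := by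
  refine ciSup_le fun a => ?_
  simp only [← Finset.sum_sub_distrib]
  have hint : ∀ t ∈ Finset.range T, Integrable (fun ω => X t ω a - X t ω (A t ω)) ν :=
    fun t ht => (h.integrable_reward hP (Finset.mem_range.1 ht) a).sub
      (h.integrable_reward_arm hP (Finset.mem_range.1 ht))
  rw [integral_finsetSum _ hint,
    integral_finsetSum _ fun t ht => h.integrable_comp_arm _ (Finset.mem_range.1 ht)]
  refine Finset.sum_le_sum fun t ht => ?_
  have ht' := Finset.mem_range.1 ht
  simp only [gap]
  rw [integral_sub (h.integrable_reward hP ht' a) (h.integrable_reward_arm hP ht'),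
    integral_sub (integrable_const _) (h.integrable_comp_arm _ ht'), h.integral_reward ht',
    h.integral_reward_arm hP ht', integral_const]
  simpa using armMean_le_iSup a

/-- An integral is controlled by a bound that holds off a small event. -/
lemma integral_le_add_mul_measureReal {f : Ω → ℝ} (hf : Integrable f ν) {B : Set Ω}
    (hB : MeasurableSet B) {C D : ℝ} (hC : 0 ≤ C) (hfC : ∀ ω ∉ B, f ω ≤ C)
    (hfD : ∀ ω, f ω ≤ D) : ∫ ω, f ω ∂ν ≤ C + D * ν.real B := by
  calc ∫ ω, f ω ∂ν ≤ ∫ ω, (C + B.indicator (fun _ => D) ω) ∂ν := by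
        refine integral_mono hf ((integrable_const _).add ((integrable_const _).indicator hB))
          fun ω => ?_
        by_cases hω : ω ∈ B
        · simp only [hω, Set.indicator_of_mem]
          linarith [hfD ω]
        · simpa [hω] using hfC ω hω
    _ = C + D * ν.real B := by
        rw [integral_add (integrable_const _) ((integrable_const _).indicator hB),
          integral_indicator_const _ hB, integral_const]
        simp [mul_comm]

end Regret

/-! ### Numerical constants and conclusion -/

/-- The constants leave room: `L ≥ 1/2` absorbs the lone `J` into `2 L J`, so `31/2 ≤ 24` is needed,
and `9 log α ≤ 8 logb 2 α` because `log 2 ≤ 8/9`. -/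
lemma add_mul_log_le_mul_logb {L J α : ℝ} (hL : Real.log 2 ≤ L) (hJ : 0 ≤ J) (hα : 1 ≤ α) :
    J + 9 / 2 * L * J * (3 + 2 * Real.log α) ≤ 8 * L * (Real.logb 2 α + 3) * J := by
  have h2 := Real.log_two_gt_d9
  have h2' := Real.log_two_lt_d9
  have hlog : 0 ≤ Real.log α := Real.log_nonneg hα
  have hb : 9 / 8 * Real.log α ≤ Real.logb 2 α := by
    rw [Real.logb, le_div_iff₀ (by linarith)]
    nlinarith
  have hLJ : J ≤ 2 * (L * J) := by nlinarith
  have h0 : 0 ≤ L * J := by nlinarith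
  nlinarith [mul_le_mul_of_nonneg_left hb h0]

end FeedbackBandit

theorem mainTheorem2 {K : ℕ} (hK : 1 ≤ K) (G : SimpleGraph (Fin K))
    (P : Measure (Fin K → ℝ)) [IsProbabilityMeasure P]
    (hP : ∀ᵐ x ∂P, ∀ a, x a ∈ Set.Icc (0 : ℝ) 1)
    (T : ℕ) (hT : 1 ≤ T) (c : ℝ) (hc : c ∈ Set.Icc (1 / 2 : ℝ) 2)
    {Ω : Type*} [mΩ : MeasurableSpace Ω] (ν : Measure Ω) [IsProbabilityMeasure ν]
    (ℱ : Filtration ℕ mΩ) (X : ℕ → Ω → Fin K → ℝ) (A : ℕ → Ω → Fin K)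
    (hXA : FeedbackBandit.IsInteraction ν P T ℱ X A)
    (hA : FeedbackBandit.FollowsUCBN G T (1 / (T : ℝ)) c X A) :
    FeedbackBandit.pseudoRegret ν T X A ≤
      8 * Real.log (2 * (K : ℝ) * (T : ℝ) ^ 2) * (Real.logb 2 (G.indepNum : ℝ) + 3)
        * FeedbackBandit.maxIndepInvGap G P + 2 := by
  have : NeZero K := ⟨by omega⟩
  have hK1 : (1 : ℝ) ≤ K := by exact_mod_cast hK
  have hT1 : (1 : ℝ) ≤ T := by exact_mod_cast hT
  have hLeq : 2 * (T : ℝ) * K / (1 / (T : ℝ)) = 2 * (K : ℝ) * (T : ℝ) ^ 2 := by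
    field_simp
  set L := Real.log (2 * (K : ℝ) * (T : ℝ) ^ 2) with hL
  have h2 : (2 : ℝ) ≤ 2 * (K : ℝ) * (T : ℝ) ^ 2 := by
    have : (1 : ℝ) ≤ (K : ℝ) * (T : ℝ) ^ 2 := one_le_mul_of_one_le_of_one_le hK1 (one_le_pow₀ hT1)
    linarith
  have hlog2 : Real.log 2 ≤ L := Real.log_le_log (by norm_num) h2
  have hL0 : 0 < L := (Real.log_pos (by norm_num)).trans_le hlog2
  obtain ⟨B, hBm, hB, hgood⟩ := hXA.exists_measure_le_forall_deviation_lt G hP hL0.le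
  have hα : 1 ≤ G.indepNum := by
    have : G.IsIndepSet (({⟨0, hK⟩} : Finset (Fin K)) : Set (Fin K)) := by simp
    simpa using this.card_le_indepNum
  have hα' : (1 : ℝ) ≤ G.indepNum := by exact_mod_cast hα
  have hJ0 : 0 ≤ FeedbackBandit.maxIndepInvGap G P := by
    simpa using FeedbackBandit.sum_inv_gap_le_maxIndepInvGap (P := P) G (I := ∅) (by simp)
  have hbound : ∀ ω ∉ B, ∑ t ∈ Finset.range T, FeedbackBandit.gap P (A t ω)
      ≤ 8 * L * (Real.logb 2 (G.indepNum : ℝ) + 3) * FeedbackBandit.maxIndepInvGap G P := by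
    intro ω hω
    refine le_trans (sum_weight_le_of_count_mul_sq_le G (FeedbackBandit.gap P)
      FeedbackBandit.gap_nonneg (FeedbackBandit.gap_le_one hP) (M := 9 / 2 * L) (by positivity)
      (fun I hI => ?_) (fun t => A t ω) T (fun t ht _ => ?_))
      (FeedbackBandit.add_mul_log_le_mul_logb hlog2 hJ0 hα')
    · convert FeedbackBandit.sum_inv_gap_le_maxIndepInvGap (P := P) G hI
    · have := FeedbackBandit.obsCount_mul_gap_sq_le (P := P) (G := G) (X := X) (A := A) (T := T)
        (δ := 1 / (T : ℝ)) (t := t) (ω := ω) (a := A t ω) hc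
        (by rw [hLeq]; exact hL0.le)
        (fun b hb => by rw [hLeq]; exact hgood ω hω t ht.le b hb) (hA t ht ω)
      rw [hLeq, ← hL] at this
      unfold FeedbackBandit.obsCount FeedbackBandit.obsRounds FeedbackBandit.Observes at this
      convert this
  -- The bad event has probability at most `2KT exp(-L) = 1/T` and costs at most `T`, so it
  -- contributes at most `1` of the additive `2`.
  have hexp : T * ν.real B ≤ 1 := by
    have : Real.exp (-L) = 1 / (2 * (K : ℝ) * (T : ℝ) ^ 2) := by
      rw [Real.exp_neg, hL, Real.exp_log (by linarith), one_div]
    rw [this] at hB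
    calc T * ν.real B ≤ T * (2 * K * T * (1 / (2 * (K : ℝ) * (T : ℝ) ^ 2))) := by gcongr
      _ = 1 := by field_simp
  have hreg := hXA.pseudoRegret_le hP
  have hint := FeedbackBandit.integral_le_add_mul_measureReal (ν := ν)
    (f := fun ω => ∑ t ∈ Finset.range T, FeedbackBandit.gap P (A t ω)) (D := T)
    (integrable_finsetSum _ fun t ht => hXA.integrable_comp_arm _ (Finset.mem_range.1 ht)) hBm
    (by have := Real.logb_nonneg one_lt_two hα'; positivity) hbound fun ω => by
      simpa using Finset.sum_le_sum fun t (_ : t ∈ Finset.range T) =>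
        FeedbackBandit.gap_le_one hP (A t ω)
  linarith
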